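/- Let $N\ge 1$, let $\Omega\subset\mathbb R^N$ be a nonempty bounded open set, $T>0$, $Q=(0,T)\times\Omega$ and $p>2$. Given $u_0:\Omega\to\mathbb R$ and $c\in\mathbb R$, a weak solution of $$u_t-\Delta_p u=0 \text{ in } Q,\qquad u=u_0 \text{ on } \{0\}\times\Omega,\qquad u=c \text{ on } (0,T)\times\partial\Omega \qquad (P_{u_0,c})$$ is a function $u\in C([0,T];L^2(\Omega))\cap L^p(0,T;W^{1,p}(\Omega))$ with $u(t)-c\in W^{1,p}_0(\Omega)$ for a.e. $t\in(0,T)$ and $u(0)=u_0$ a.e. in $\Omega$, such that $$\int_\Omega u(t_2)\varphi(t_2)\,dx-\int_\Omega u(t_1)\varphi(t_1)\,dx+\int_{t_1}^{t_2}\int_\Omega\bigl(-u\,\varphi_t+|\nabla u|^{p-2}\nabla u\cdot\nabla\varphi\bigr)\,dx\,dt=0$$ for all $0\le t_1\le t_2\le T$ and all $\varphi\in W^{1,2}(0,T;L^2(\Omega))\cap L^p(0,T;W^{1,p}_0(\Omega))$. **Proposition 4.2.** For each integer $n\ge1$ let $u_n$ be a weak solution of $(P_{0,n})$, that is, with zero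 initial datum and boundary value $n$. Then there is a measurable set $E\subseteq Q$ of positive Lebesgue measure such that $u_n(t,x)\to\infty$ as $n\to\infty$ for every $(t,x)\in E$. Consequently there are no large solutions for $p>2$, in the following sense. Let $g_n\ge 0$ a.e. in $\Omega$ be arbitrary initial data and $w_n$ a weak solution of $(P_{g_n,n})$ for each $n\ge1$ (for instance $g_n=\min(u_0,n)$ with $0\le u_0\in L^1_{\rm loc}(\Omega)$). Then there is no function $U:Q\to\mathbb R$ with $U(t)\in L^1_{\rm loc}(\Omega)$ for a.e. $t\in(0,T)$ that is an upper barrier for the approximating problems, i.e. that satisfies $w_n\le U$ a.e. in $Q$ for every $n\ge1$. -/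

import Mathlib

open Set Filter Topology MeasureTheory
open scoped ContDiff

namespace LargeSolutions

/-- `ℝ^N` with the Euclidean norm. -/
abbrev Space (N : ℕ) : Type := EuclideanSpace ℝ (Fin N)

/-- The space-time cylinder `Q = (0, T) × Ω`. -/
def cylinder {N : ℕ} (Ω : Set (Space N)) (T : ℝ) : Set (ℝ × Space N) :=
  Ioo 0 T ×ˢ Ω

/-- `φ ∈ C_c^∞(Ω)`. -/
def IsTestFun {N : ℕ} (Ω : Set (Space N)) (φ : Space N → ℝ) : Prop :=
  ContDiff ℝ ∞ φ ∧ HasCompactSupport φ ∧ tsupport φ ⊆ Ω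

/-- `f ∈ W^{1,p}(Ω)` with weak gradient `G`. -/
structure MemW1p {N : ℕ} (Ω : Set (Space N)) (p : ℝ) (f : Space N → ℝ)
    (G : Space N → Space N) : Prop where
  memLp : MemLp f (ENNReal.ofReal p) (volume.restrict Ω)
  memLp_grad : MemLp G (ENNReal.ofReal p) (volume.restrict Ω)
  weak_grad : ∀ φ : Space N → ℝ, IsTestFun Ω φ → ∀ i : Fin N,
    ∫ x in Ω, f x * gradient φ x i = -∫ x in Ω, G x i * φ x

/-- `f ∈ W_0^{1,p}(Ω)` with weak gradient `G`, where `W_0^{1,p}(Ω)` is the closure of `C_c^∞(Ω)`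
in `W^{1,p}(Ω)`. -/
structure MemW1pZero {N : ℕ} (Ω : Set (Space N)) (p : ℝ) (f : Space N → ℝ)
    (G : Space N → Space N) : Prop extends MemW1p Ω p f G where
  approx : ∃ φ : ℕ → Space N → ℝ, (∀ k, IsTestFun Ω (φ k)) ∧
    Tendsto (fun k => eLpNorm (fun x => φ k x - f x) (ENNReal.ofReal p) (volume.restrict Ω))
      atTop (𝓝 0) ∧
    Tendsto (fun k => eLpNorm (fun x => gradient (φ k) x - G x) (ENNReal.ofReal p)
      (volume.restrict Ω)) atTop (𝓝 0)

/-- The admissible test functions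
`φ ∈ W^{1,2}(0, T; L^2(Ω)) ∩ L^p(0, T; W_0^{1,p}(Ω))`, with time derivative `ψ` and spatial
gradient `H`; `φ` is taken in its representative in `C([0, T]; L^2(Ω))`. -/
structure IsParabolicTest {N : ℕ} (Ω : Set (Space N)) (T p : ℝ) (φ ψ : ℝ → Space N → ℝ)
    (H : ℝ → Space N → Space N) : Prop where
  memLp : MemLp (Function.uncurry φ) (ENNReal.ofReal p) (volume.restrict (cylinder Ω T))
  memLp_grad : MemLp (Function.uncurry H) (ENNReal.ofReal p) (volume.restrict (cylinder Ω T))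
  zero_trace : ∀ᵐ t ∂(volume.restrict (Ioo 0 T)), MemW1pZero Ω p (φ t) (H t)
  memLp_slice : ∀ t ∈ Icc 0 T, MemLp (φ t) 2 (volume.restrict Ω)
  memLp_deriv : MemLp (Function.uncurry ψ) 2 (volume.restrict (cylinder Ω T))
  time_deriv : ∀ s ∈ Icc 0 T, ∀ t ∈ Icc 0 T, ∀ᵐ x ∂(volume.restrict Ω),
    φ t x - φ s x = ∫ r in s..t, ψ r x

/-- `u` is a weak solution of `u_t - Δ_p u = 0` in `Q = (0, T) × Ω`, with initial datum `u₀` and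
constant lateral boundary value `c`:
`u ∈ C([0, T]; L^2(Ω)) ∩ L^p(0, T; W^{1,p}(Ω))`, the function `u(t) - c` is in `W_0^{1,p}(Ω)` for
a.e. `t`, `u(0) = u₀`, and the equation holds in integrated form on all `[t₁, t₂] ⊆ [0, T]`. -/
def IsWeakSolution {N : ℕ} (Ω : Set (Space N)) (T p : ℝ) (u₀ : Space N → ℝ) (c : ℝ)
    (u : ℝ → Space N → ℝ) : Prop :=
  (∀ t ∈ Icc 0 T, MemLp (u t) 2 (volume.restrict Ω)) ∧
  (∀ s ∈ Icc 0 T, Tendsto (fun t => eLpNorm (fun x => u t x - u s x) 2 (volume.restrict Ω))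
    (𝓝[Icc 0 T] s) (𝓝 0)) ∧
  u 0 =ᵐ[volume.restrict Ω] u₀ ∧
  ∃ G : ℝ → Space N → Space N,
    MemLp (Function.uncurry u) (ENNReal.ofReal p) (volume.restrict (cylinder Ω T)) ∧
    MemLp (Function.uncurry G) (ENNReal.ofReal p) (volume.restrict (cylinder Ω T)) ∧
    (∀ᵐ t ∂(volume.restrict (Ioo 0 T)),
      MemW1p Ω p (u t) (G t) ∧ MemW1pZero Ω p (fun x => u t x - c) (G t)) ∧
    ∀ (φ ψ : ℝ → Space N → ℝ) (H : ℝ → Space N → Space N), IsParabolicTest Ω T p φ ψ H →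
      ∀ t₁ t₂ : ℝ, 0 ≤ t₁ → t₁ ≤ t₂ → t₂ ≤ T →
        (∫ x in Ω, u t₂ x * φ t₂ x) - (∫ x in Ω, u t₁ x * φ t₁ x)
          + ∫ z in Ioo t₁ t₂ ×ˢ Ω, (-(u z.1 z.2 * ψ z.1 z.2)
            + ‖G z.1 z.2‖ ^ (p - 2) * inner ℝ (G z.1 z.2) (H z.1 z.2)) = 0

/-- The two requirements that any notion of large solution has to meet: `U(t) ∈ L^1_loc(Ω)` for
a.e. `t ∈ (0, T)`, and `U` is an upper barrier (a.e. in `Q`) for the solutions `w n`, `n ≥ 1`, of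
the approximating problems with boundary value `n`. -/
structure IsLargeSolution {N : ℕ} (Ω : Set (Space N)) (T : ℝ) (w : ℕ → ℝ → Space N → ℝ)
    (U : ℝ → Space N → ℝ) : Prop where
  locallyIntegrable : ∀ᵐ t ∂(volume.restrict (Ioo 0 T)), LocallyIntegrableOn (U t) Ω
  upper_barrier : ∀ n : ℕ, 1 ≤ n →
    ∀ᵐ z ∂(volume.restrict (cylinder Ω T)), w n z.1 z.2 ≤ U z.1 z.2

end LargeSolutions

namespace LargeSolutions

/-! For a solution with boundary value `c`, put `y(t) = ∫ (u(t) - c)²`. Testing with `u - c` gives,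
formally, `y' = -2 ∫ |∇u|^p`, and the Poincaré inequality turns this into `y' ≤ -2k y^(p/2)`. Since
`p/2 > 1`, such a `y` comes down from infinity: `y(t) ≤ (κ t)^(-1/(p/2 - 1))`, where `κ` depends
neither on the initial datum nor on `c` (`exists_universal_energy_bound`).

Hence `u_n - n` is bounded in `L²((T/2, T) × Ω)` uniformly in `n`. Dividing the squares by `n²`
makes their integrals summable, so `(u_n - n)/n → 0` a.e. there and `u_n ≥ n/2` eventually
(`ae_tendsto_atTop`). The initial data play no role, so the same divergence rules out any
real-valued barrier.

The delicate point is the energy inequality: `u - c` need not have a time derivative in `L²`, so it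
is not an admissible test function. Instead the frozen slice `u(s) - c` is used on `[s - h, s]`,
convexity of the square bounds `y(s) - y(s - h)`, and the result is integrated in `s`, divided by
`h` and passed to the limit by continuity of translations in `L^(p')`, `p' = p/(p-1)`
(`energy_inequality_of_slices`). -/

/-! ### Decay under a superlinear difference inequality -/

/-- A derivative-free form of `y' ≤ -c y^q`. If `y t` exceeded the bound, `y` would at least double
at each step back along the times `t r^k`, which stay positive, contradicting boundedness. The bound
`B` serves only for this contradiction and does not enter the estimate. -/
theorem rpow_decay {y : ℝ → ℝ} {T c q B : ℝ} (hc : 0 < c) (hq : 1 < q)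
    (hyB : ∀ t ∈ Ioo 0 T, y t ≤ B)
    (hdec : ∀ a b, 0 < a → a < b → b < T → y b - y a ≤ -(c * (b - a) * y b ^ q))
    {t : ℝ} (ht : t ∈ Ioo 0 T) :
    y t ≤ (c * t * (1 - (2 : ℝ) ^ (1 - q))) ^ (-(q - 1)⁻¹) := by
  set r : ℝ := (2 : ℝ) ^ (1 - q) with hr
  have hr0 : 0 < r := by positivity
  have hr1 : r < 1 := Real.rpow_lt_one_of_one_lt_of_neg (by norm_num) (by linarith)
  have hX : 0 < c * t * (1 - r) := mul_pos (mul_pos hc ht.1) (by linarith)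
  set M : ℝ := (c * t * (1 - r)) ^ (-(q - 1)⁻¹) with hM
  have hM0 : 0 < M := Real.rpow_pos_of_pos hX _
  have hMq : M ^ (q - 1) = (c * t * (1 - r))⁻¹ := by
    rw [hM, ← Real.rpow_mul hX.le, neg_mul, inv_mul_cancel₀ (by linarith), Real.rpow_neg_one]
  by_contra! hlt
  have key : ∀ k : ℕ, 2 ^ k * M ≤ y (t * r ^ k) := by
    intro k
    induction k with
    | zero => simpa using hlt.le
    | succ k ih =>
      have hrk : 0 < r ^ k := by positivity
      have hrk1 : r ^ k ≤ 1 := pow_le_one₀ hr0.le hr1.le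
      have hb : t * r ^ k < T := lt_of_le_of_lt (mul_le_of_le_one_right ht.1.le hrk1) ht.2
      have hab : t * r ^ (k + 1) < t * r ^ k := by
        rw [pow_succ]
        have := mul_pos ht.1 hrk
        nlinarith
      have h := hdec (t * r ^ (k + 1)) (t * r ^ k) (by have := ht.1; positivity) hab hb
      have h1 : (2 ^ k * M) ^ q ≤ y (t * r ^ k) ^ q :=
        Real.rpow_le_rpow (by positivity) ih (by linarith)
      -- The choices of `r` and `M` make the guaranteed drop over the `k`-th gap equal to the level
      -- `2 ^ k * M` itself, hence the doubling.
      have h2 : c * (t * r ^ k - t * r ^ (k + 1)) * (2 ^ k * M) ^ q = 2 ^ k * M := by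
        have e1 : (2 ^ k * M) ^ q = (2 ^ k * M) * ((2 ^ k * M) ^ (q - 1)) := by
          rw [Real.rpow_sub_one (by positivity)]
          field_simp
        have e2 : (2 ^ k * M : ℝ) ^ (q - 1) = (r ^ k)⁻¹ * (c * t * (1 - r))⁻¹ := by
          rw [Real.mul_rpow (by positivity) hM0.le, hMq]
          congr 1
          rw [hr, ← Real.rpow_natCast, ← Real.rpow_natCast, ← Real.rpow_mul (by norm_num),
            ← Real.rpow_mul (by norm_num), ← Real.rpow_neg (by norm_num)]
          congr 1
          ring
        rw [e1, e2, pow_succ]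
        have : (1 - r) ≠ 0 := by linarith
        have := ht.1.ne'
        field_simp
      have h3 : 0 ≤ c * (t * r ^ k - t * r ^ (k + 1)) := mul_nonneg hc.le (by linarith)
      have h4 := mul_le_mul_of_nonneg_left h1 h3
      rw [pow_succ]
      linarith
  obtain ⟨k, hk⟩ := pow_unbounded_of_one_lt (B / M) (one_lt_two : (1 : ℝ) < 2)
  have hrk1 : r ^ k ≤ 1 := pow_le_one₀ hr0.le hr1.le
  have := hyB (t * r ^ k) ⟨by have := ht.1; positivity,
    lt_of_le_of_lt (mul_le_of_le_one_right ht.1.le hrk1) ht.2⟩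
  have h5 := key k
  rw [div_lt_iff₀ hM0] at hk
  linarith

/-! ### Poincaré inequality on a bounded set -/

theorem gradient_eq_zero_of_notMem_tsupport {N : ℕ} {φ : Space N → ℝ} {x : Space N}
    (hx : x ∉ tsupport φ) : gradient φ x = 0 := by
  have : fderiv ℝ φ x = 0 := by
    by_contra h
    exact hx (support_fderiv_subset ℝ h)
  simp [gradient, this]

theorem IsTestFun.continuous_gradient {N : ℕ} {Ω : Set (Space N)} {φ : Space N → ℝ}
    (hφ : IsTestFun Ω φ) : Continuous (gradient φ) :=
  (LinearIsometryEquiv.continuous _).comp (hφ.1.continuous_fderiv (by simp))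

/-- Since `∂ᵢ xᵢ = 1`, integration by parts gives `∫ φ² = -∫ 2 φ ∂ᵢφ xᵢ`. On the support `|xᵢ| ≤ R`,
and Young's inequality lets half of `∫ φ²` be absorbed on the left. -/
theorem IsTestFun.integral_sq_le {N : ℕ} {Ω : Set (Space N)} {φ : Space N → ℝ}
    (hφ : IsTestFun Ω φ) (i : Fin N) {R : ℝ} (hR : ∀ x ∈ Ω, ‖x‖ ≤ R) :
    ∫ x, φ x ^ 2 ≤ (2 * R) ^ 2 * ∫ x, ‖gradient φ x‖ ^ 2 := by
  have hgrad : Continuous (gradient φ) := hφ.continuous_gradient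
  obtain ⟨hs, hc, hsub⟩ := hφ
  have hd : Differentiable ℝ φ := hs.differentiable (by simp)
  have hfd : Continuous (fderiv ℝ φ) := hs.continuous_fderiv (by simp)
  have hgc : HasCompactSupport (gradient φ) :=
    HasCompactSupport.intro hc fun x hx => gradient_eq_zero_of_notMem_tsupport hx
  set e : Space N := EuclideanSpace.single i 1 with he
  have hce : Continuous fun x : Space N => x i := by fun_prop
  have hi1 : Integrable (fun x => φ x ^ 2) := by
    have : MemLp φ 2 := hd.continuous.memLp_of_hasCompactSupport hc
    exact this.integrable_sq
  have hi2 : Integrable (fun x => ‖gradient φ x‖ ^ 2) := by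
    have : MemLp (gradient φ) 2 := hgrad.memLp_of_hasCompactSupport hgc
    exact this.integrable_norm_pow (by norm_num)
  have hfx : ∀ x, fderiv ℝ (fun x : Space N => x i) x e = 1 := by
    intro x
    have : (fun x : Space N => x i) = (EuclideanSpace.proj i : Space N →L[ℝ] ℝ) := rfl
    rw [this, ContinuousLinearMap.fderiv]
    simp [he]
  have hfsq : ∀ x, fderiv ℝ (fun x => φ x ^ 2) x e = 2 * φ x * fderiv ℝ φ x e := by
    intro x
    rw [fderiv_fun_pow _ (hd x)]
    simp
  have hmon : ∀ f : Space N → ℝ, HasCompactSupport fun x => φ x * f x := fun f =>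
    hc.mono fun x hx => by
      contrapose! hx
      simp only [Function.mem_support, not_not] at hx
      simp [hx]
  have hfe : Continuous fun x => fderiv ℝ φ x e := by fun_prop
  have hi3 : Integrable (fun x : Space N => φ x * (2 * fderiv ℝ φ x e * x i)) :=
    Continuous.integrable_of_hasCompactSupport (by have := hd.continuous; fun_prop) (hmon _)
  have hi4 : Integrable (fun x : Space N => φ x ^ 2 * x i) := by
    have : (fun x : Space N => φ x ^ 2 * x i) = fun x => φ x * (φ x * x i) := by ext; ring
    rw [this]
    exact Continuous.integrable_of_hasCompactSupport (by have := hd.continuous; fun_prop) (hmon _)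
  have hi5 : Integrable (fun x => fderiv ℝ (fun x => φ x ^ 2) x e * x i) := by
    simp_rw [hfsq]
    exact hi3.congr (.of_forall fun x => by simp only []; ring)
  have hi6 : Integrable (fun x => φ x ^ 2 * fderiv ℝ (fun x : Space N => x i) x e) := by
    simp_rw [hfx, mul_one]
    exact hi1
  have hd2 : Differentiable ℝ fun x => φ x ^ 2 := hd.pow 2
  have hdx : Differentiable ℝ fun x : Space N => x i :=
    (EuclideanSpace.proj i : Space N →L[ℝ] ℝ).differentiable
  have hparts := integral_mul_fderiv_eq_neg_fderiv_mul_of_integrable hi5 hi6 hi4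
    (fun x _ => hd2 x) (fun x _ => hdx x)
  simp_rw [hfx, mul_one, hfsq] at hparts
  have hpt : ∀ x, -(2 * φ x * fderiv ℝ φ x e * x i) ≤
      2⁻¹ * φ x ^ 2 + 2 * R ^ 2 * ‖gradient φ x‖ ^ 2 := by
    intro x
    by_cases hx : x ∈ tsupport φ
    · have h1 : |x i| ≤ R := (PiLp.norm_apply_le x i).trans (hR x (hsub hx))
      have h2 : |fderiv ℝ φ x e| ≤ ‖gradient φ x‖ := by
        have := (fderiv ℝ φ x).le_opNorm e
        simpa [he, gradient] using this
      have h3 : |fderiv ℝ φ x e * x i| ≤ ‖gradient φ x‖ * R := by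
        rw [abs_mul]
        exact mul_le_mul h2 h1 (abs_nonneg _) (norm_nonneg _)
      have h4 := sq_le_sq' (abs_le.1 h3).1 (abs_le.1 h3).2
      nlinarith [sq_nonneg (φ x + 2 * (fderiv ℝ φ x e * x i))]
    · have : φ x = 0 := image_eq_zero_of_notMem_tsupport hx
      rw [this]
      have : 0 ≤ 2 * R ^ 2 * ‖gradient φ x‖ ^ 2 := by positivity
      simpa using this
  have hi7 : Integrable (fun x => -(2 * φ x * fderiv ℝ φ x e * x i)) :=
    hi3.neg.congr (.of_forall fun x => by simp only [Pi.neg_apply]; ring)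
  have hle := integral_mono hi7 ((hi1.const_mul 2⁻¹).add (hi2.const_mul (2 * R ^ 2))) hpt
  simp only [Pi.add_apply] at hle
  rw [integral_neg, integral_add (hi1.const_mul _) (hi2.const_mul _), integral_const_mul,
    integral_const_mul, ← hparts] at hle
  linarith

theorem eLpNorm_two_eq_sqrt {α E : Type*} [MeasurableSpace α] {μ : Measure α}
    [NormedAddCommGroup E] {f : α → E} (hf : MemLp f 2 μ) :
    eLpNorm f 2 μ = ENNReal.ofReal √(∫ x, ‖f x‖ ^ 2 ∂μ) := by
  rw [hf.eLpNorm_eq_integral_rpow_norm (by norm_num) (by norm_num), Real.sqrt_eq_rpow]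
  norm_num

theorem IsTestFun.eLpNorm_two_le {N : ℕ} {Ω : Set (Space N)} {φ : Space N → ℝ}
    (hφ : IsTestFun Ω φ) (i : Fin N) {R : ℝ} (hR0 : 0 ≤ R) (hR : ∀ x ∈ Ω, ‖x‖ ≤ R) :
    eLpNorm φ 2 (volume.restrict Ω) ≤
      ENNReal.ofReal (2 * R) * eLpNorm (gradient φ) 2 (volume.restrict Ω) := by
  have hg0 : ∀ x ∉ Ω, gradient φ x = 0 := fun x hx =>
    gradient_eq_zero_of_notMem_tsupport fun h => hx (hφ.2.2 h)
  have h0 : ∀ x ∉ Ω, φ x = 0 := fun x hx =>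
    image_eq_zero_of_notMem_tsupport fun h => hx (hφ.2.2 h)
  have hgc : HasCompactSupport (gradient φ) :=
    HasCompactSupport.intro hφ.2.1 fun x hx => gradient_eq_zero_of_notMem_tsupport hx
  have hm1 : MemLp φ 2 (volume.restrict Ω) :=
    (hφ.1.continuous.memLp_of_hasCompactSupport hφ.2.1).restrict _
  have hm2 : MemLp (gradient φ) 2 (volume.restrict Ω) :=
    (hφ.continuous_gradient.memLp_of_hasCompactSupport hgc).restrict _
  rw [eLpNorm_two_eq_sqrt hm1, eLpNorm_two_eq_sqrt hm2, ← ENNReal.ofReal_mul (by positivity)]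
  refine ENNReal.ofReal_le_ofReal ?_
  rw [setIntegral_eq_integral_of_forall_compl_eq_zero (fun x hx => by simp [h0 x hx]),
    setIntegral_eq_integral_of_forall_compl_eq_zero (fun x hx => by simp [hg0 x hx])]
  refine Real.sqrt_le_iff.2 ⟨by positivity, ?_⟩
  rw [mul_pow, Real.sq_sqrt (integral_nonneg fun x => by positivity)]
  simpa using hφ.integral_sq_le i hR

/-- The `L²` inequality for test functions passes to their `W^{1,p}` closure; Hölder on the finite
measure of `Ω` compares `L²` with `L^p` and produces the exponent `1/2 - 1/p`. -/
theorem MemW1pZero.eLpNorm_two_le {N : ℕ} {Ω : Set (Space N)} {p : ℝ} (hp : 2 < p)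
    {f : Space N → ℝ} {G : Space N → Space N} (h : MemW1pZero Ω p f G) (i : Fin N) {R : ℝ}
    (hR0 : 0 ≤ R) (hR : ∀ x ∈ Ω, ‖x‖ ≤ R) (hΩ : volume Ω ≠ ⊤) :
    eLpNorm f 2 (volume.restrict Ω) ≤ ENNReal.ofReal (2 * R) * volume Ω ^ (1 / 2 - 1 / p) *
      eLpNorm G (ENNReal.ofReal p) (volume.restrict Ω) := by
  obtain ⟨φ, hφ, h1, h2⟩ := h.approx
  set μ := volume.restrict Ω with hμ
  have hμu : μ univ = volume Ω := by simp [hμ]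
  set P := ENNReal.ofReal p with hP
  have h2P : (2 : ENNReal) ≤ P := by
    rw [hP, ← ENNReal.ofReal_ofNat 2]
    exact ENNReal.ofReal_le_ofReal hp.le
  have hPr : P.toReal = p := ENNReal.toReal_ofReal (by linarith)
  set D := volume Ω ^ (1 / 2 - 1 / p) with hD
  have hDtop : D ≠ ⊤ := by
    refine ENNReal.rpow_ne_top_of_nonneg ?_ hΩ
    have : 1 / p ≤ 1 / 2 := one_div_le_one_div_of_le (by norm_num) hp.le
    linarith
  have hexp : ∀ {E : Type} [NormedAddCommGroup E] {F : Space N → E}, AEStronglyMeasurable F μ →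
      eLpNorm F 2 μ ≤ eLpNorm F P μ * D := fun hF => by
    have := eLpNorm_le_eLpNorm_mul_rpow_measure_univ h2P hF
    rwa [hμu, hPr, ENNReal.toReal_ofNat] at this
  have hbd : ∀ k, eLpNorm f 2 μ ≤ eLpNorm (fun x => φ k x - f x) P μ * D +
      ENNReal.ofReal (2 * R) * ((eLpNorm (fun x => gradient (φ k) x - G x) P μ +
        eLpNorm G P μ) * D) := by
    intro k
    have mφ : AEStronglyMeasurable (φ k) μ := (hφ k).1.continuous.aestronglyMeasurable
    have mg : AEStronglyMeasurable (gradient (φ k)) μ :=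
      (hφ k).continuous_gradient.aestronglyMeasurable
    have mf := h.memLp.1
    have mG := h.memLp_grad.1
    have e1 : f = φ k - fun x => φ k x - f x := by ext; simp
    have e2 : gradient (φ k) = (fun x => gradient (φ k) x - G x) + G := by ext1; simp
    calc eLpNorm f 2 μ ≤ eLpNorm (φ k) 2 μ + eLpNorm (fun x => φ k x - f x) 2 μ := by
          conv_lhs => rw [e1]
          exact eLpNorm_sub_le mφ (mφ.sub mf) (by norm_num)
      _ ≤ ENNReal.ofReal (2 * R) * eLpNorm (gradient (φ k)) 2 μ +
          eLpNorm (fun x => φ k x - f x) P μ * D :=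
        add_le_add ((hφ k).eLpNorm_two_le i hR0 hR) (hexp (mφ.sub mf))
      _ ≤ _ := by
        rw [add_comm]
        gcongr
        refine (hexp mg).trans ?_
        gcongr
        conv_lhs => rw [e2]
        exact eLpNorm_add_le (mg.sub mG) mG (le_trans (by norm_num) h2P)
  have hlim : Tendsto (fun k => eLpNorm (fun x => φ k x - f x) P μ * D +
      ENNReal.ofReal (2 * R) * ((eLpNorm (fun x => gradient (φ k) x - G x) P μ +
        eLpNorm G P μ) * D)) atTop (𝓝 (0 * D + ENNReal.ofReal (2 * R) *
          ((0 + eLpNorm G P μ) * D))) := by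
    refine (ENNReal.Tendsto.mul_const h1 (.inr hDtop)).add ?_
    exact ENNReal.Tendsto.const_mul (ENNReal.Tendsto.mul_const (h2.add_const _) (.inr hDtop))
      (.inr ENNReal.ofReal_ne_top)
  refine (ge_of_tendsto' hlim hbd).trans (le_of_eq ?_)
  ring

theorem exists_poincare {N : ℕ} (hN : 1 ≤ N) {Ω : Set (Space N)} (hΩ : Bornology.IsBounded Ω)
    {p : ℝ} (hp : 2 < p) : ∃ c : ℝ, 0 < c ∧ ∀ (f : Space N → ℝ) (G : Space N → Space N),
      MemW1pZero Ω p f G → c * (∫ x in Ω, f x ^ 2) ^ (p / 2) ≤ ∫ x in Ω, ‖G x‖ ^ p := by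
  obtain ⟨R, hR⟩ := hΩ.exists_norm_le
  have hfin : volume Ω ≠ ⊤ := hΩ.measure_lt_top.ne
  have : IsFiniteMeasure (volume.restrict Ω) := ⟨by simpa using hfin.lt_top⟩
  have hdtop : ENNReal.ofReal (2 * |R|) * volume Ω ^ (1 / 2 - 1 / p) ≠ ⊤ := by
    refine ENNReal.mul_ne_top ENNReal.ofReal_ne_top (ENNReal.rpow_ne_top_of_nonneg ?_ hfin)
    have : 1 / p ≤ 1 / 2 := one_div_le_one_div_of_le (by norm_num) hp.le
    linarith
  -- The summand `1` keeps `D` positive when the Poincaré factor vanishes, for instance for empty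
  -- `Ω`.
  set D := (ENNReal.ofReal (2 * |R|) * volume Ω ^ (1 / 2 - 1 / p)).toReal + 1 with hD
  have hD0 : 0 < D := by positivity
  refine ⟨(D ^ p)⁻¹, by positivity, fun f G h => ?_⟩
  have h2P : (2 : ENNReal) ≤ ENNReal.ofReal p := by
    rw [← ENNReal.ofReal_ofNat 2]
    exact ENNReal.ofReal_le_ofReal hp.le
  have hP0 : ENNReal.ofReal p ≠ 0 := (lt_of_lt_of_le (by norm_num) h2P).ne'
  have key := h.eLpNorm_two_le hp ⟨0, hN⟩ (abs_nonneg R) (fun x hx => (hR x hx).trans (le_abs_self R))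
    hfin
  rw [eLpNorm_two_eq_sqrt (h.memLp.mono_exponent h2P),
    h.memLp_grad.eLpNorm_eq_integral_rpow_norm hP0 ENNReal.ofReal_ne_top,
    ENNReal.toReal_ofReal (by linarith), ← ENNReal.ofReal_toReal hdtop,
    ← ENNReal.ofReal_mul ENNReal.toReal_nonneg] at key
  have hI : 0 ≤ ∫ x in Ω, ‖G x‖ ^ p := integral_nonneg fun x => by positivity
  have hJ : 0 ≤ ∫ x in Ω, f x ^ 2 := integral_nonneg fun x => by positivity
  rw [ENNReal.ofReal_le_ofReal_iff (by positivity)] at key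
  have key2 : √(∫ x in Ω, f x ^ 2) ≤ D * (∫ x in Ω, ‖G x‖ ^ p) ^ p⁻¹ := by
    simp only [Real.norm_eq_abs, sq_abs] at key
    refine key.trans ?_
    gcongr
    simp [hD]
  have key3 := Real.rpow_le_rpow (Real.sqrt_nonneg _) key2 (by linarith : 0 ≤ p)
  rw [Real.mul_rpow hD0.le (by positivity), ← Real.rpow_mul hI, inv_mul_cancel₀ (by linarith),
    Real.rpow_one, Real.sqrt_eq_rpow, ← Real.rpow_mul hJ] at key3
  rw [inv_mul_le_iff₀ (by positivity)]
  rwa [show 1 / 2 * p = p / 2 by ring] at key3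

/-! ### Time translations and passage from slices to the energy inequality -/

theorem integrable_inner_of_memLp {α E : Type*} [MeasurableSpace α] {μ : Measure α}
    [NormedAddCommGroup E] [InnerProductSpace ℝ E] {q p : ENNReal} [ENNReal.HolderTriple q p 1]
    {f g : α → E} (hf : MemLp f q μ) (hg : MemLp g p μ) :
    Integrable (fun z => inner ℝ (f z) (g z)) μ :=
  (hf.norm.integrable_mul hg.norm).mono (hf.1.inner hg.1)
    (.of_forall fun z => by simpa using abs_real_inner_le_norm (f z) (g z))

instance instVAddInvariantMeasureProd {N : ℕ} : VAddInvariantMeasure (ℝ × Space N) (ℝ × Space N)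
    (volume : Measure (ℝ × Space N)) := by
  have : (volume : Measure (ℝ × Space N)).IsAddLeftInvariant := by
    rw [Measure.volume_eq_prod]
    infer_instance
  infer_instance

theorem measurePreserving_time_shift {N : ℕ} (r : ℝ) :
    MeasurePreserving (fun z : ℝ × Space N => (z.1 - r, z.2)) volume volume := by
  have := measurePreserving_vadd ((-r, 0) : ℝ × Space N) (volume : Measure (ℝ × Space N))
  convert this using 2 with z
  simp [Prod.ext_iff, sub_eq_neg_add]

/-- Translations act continuously on `L^q` for finite `q`, and the duality pairing with a fixed `g`
in `L^p` is continuous. -/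
theorem continuous_integral_inner_shift {N : ℕ} {E : Type*} [NormedAddCommGroup E]
    [InnerProductSpace ℝ E] {q p : ENNReal} [ENNReal.HolderTriple q p 1] [Fact (1 ≤ q)]
    [Fact (q ≠ ⊤)] [Fact (1 ≤ p)] {f g : ℝ × Space N → E} (hf : MemLp f q) (hg : MemLp g p) :
    Continuous fun r : ℝ => ∫ z, inner ℝ (f (z.1 - r, z.2)) (g z) := by
  let B : E →L[ℝ] E →L[ℝ] ℝ := innerSL ℝ
  have hc : Continuous fun r : ℝ => B.lpPairing volume q p
      (DomAddAct.mk ((-r, 0) : ℝ × Space N) +ᵥ hf.toLp f) (hg.toLp g) := by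
    have h1 : Continuous fun r : ℝ =>
        DomAddAct.mk ((-r, 0) : ℝ × Space N) +ᵥ hf.toLp f := by
      have h2 : Continuous fun r : ℝ => DomAddAct.mk ((-r, 0) : ℝ × Space N) :=
        DomAddAct.continuous_mk.comp (by fun_prop)
      exact h2.vadd continuous_const
    exact ((B.lpPairing volume q p).continuous.comp h1).clm_apply continuous_const
  refine hc.congr fun r => ?_
  rw [ContinuousLinearMap.lpPairing_eq_integral, DomAddAct.mk_vadd_toLp]
  refine integral_congr_ae ?_
  have hr : MemLp (fun z => f (((-r, 0) : ℝ × Space N) +ᵥ z)) q :=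
    hf.comp_measurePreserving (measurePreserving_vadd ((-r, 0) : ℝ × Space N) volume)
  filter_upwards [hr.coeFn_toLp, hg.coeFn_toLp] with z h1 h2
  rw [h1, h2]
  have : ((-r, 0) : ℝ × Space N) +ᵥ z = (z.1 - r, z.2) := by
    simp [Prod.ext_iff, sub_eq_neg_add]
  rw [this]
  rfl

theorem ae_memLp_slice {α β E : Type*} [MeasurableSpace α] [MeasurableSpace β] {μ : Measure α}
    {ν : Measure β} [SFinite μ] [SFinite ν] [NormedAddCommGroup E] {p : ENNReal} (hp0 : p ≠ 0)
    (hp : p ≠ ⊤) {g : α × β → E} (hgm : StronglyMeasurable g) (hg : MemLp g p (μ.prod ν)) :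
    ∀ᵐ s ∂μ, MemLp (fun x => g (s, x)) p ν := by
  filter_upwards [(hg.integrable_norm_rpow hp0 hp).prod_right_ae] with s hs
  exact (integrable_norm_rpow_iff
    (hgm.comp_measurable measurable_prodMk_left).aestronglyMeasurable hp0 hp).1 hs

/-- Tonelli applies because the integral of the norms over `z` is continuous in the shift, hence
integrable over a bounded interval. -/
theorem integrable_inner_shift {N : ℕ} {E : Type*} [NormedAddCommGroup E]
    [InnerProductSpace ℝ E] {q p : ENNReal} [ENNReal.HolderTriple q p 1] [Fact (1 ≤ q)]
    [Fact (q ≠ ⊤)] [Fact (1 ≤ p)] {f g : ℝ × Space N → E} (hfm : StronglyMeasurable f)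
    (hgm : StronglyMeasurable g) (hf : MemLp f q) (hg : MemLp g p) (h : ℝ) :
    Integrable (fun w : ℝ × (ℝ × Space N) => inner ℝ (f (w.2.1 - w.1, w.2.2)) (g w.2))
      ((volume.restrict (Ioo 0 h)).prod volume) := by
  have hm : Measurable fun w : ℝ × (ℝ × Space N) => (w.2.1 - w.1, w.2.2) := by fun_prop
  have hf1 : StronglyMeasurable fun w : ℝ × (ℝ × Space N) => f (w.2.1 - w.1, w.2.2) :=
    hfm.comp_measurable hm
  have hg1 : StronglyMeasurable fun w : ℝ × (ℝ × Space N) => g w.2 :=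
    hgm.comp_measurable measurable_snd
  have hcont := continuous_integral_inner_shift hf.norm hg.norm
  have hshift : ∀ r : ℝ, MemLp (fun z : ℝ × Space N => f (z.1 - r, z.2)) q := fun r =>
    hf.comp_measurePreserving (measurePreserving_time_shift r)
  have hmaj : Integrable (fun w : ℝ × (ℝ × Space N) => ‖f (w.2.1 - w.1, w.2.2)‖ * ‖g w.2‖)
      ((volume.restrict (Ioo 0 h)).prod volume) := by
    have hfg : StronglyMeasurable fun w : ℝ × (ℝ × Space N) =>
        ‖f (w.2.1 - w.1, w.2.2)‖ * ‖g w.2‖ := hf1.norm.mul hg1.norm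
    rw [integrable_prod_iff hfg.aestronglyMeasurable]
    refine ⟨.of_forall fun r => (hshift r).norm.integrable_mul hg.norm, ?_⟩
    have : IntegrableOn (fun r : ℝ => ∫ z : ℝ × Space N, ‖f (z.1 - r, z.2)‖ * ‖g z‖) (Ioo 0 h) := by
      refine (Continuous.integrableOn_Icc (a := 0) (b := h) ?_).mono_set Ioo_subset_Icc_self
      simpa [mul_comm] using hcont
    simpa [IntegrableOn] using this
  exact hmaj.mono (hf1.inner hg1).aestronglyMeasurable
    (.of_forall fun w => by simpa using abs_real_inner_le_norm _ _)

theorem setIntegral_Ioo_comp_sub_left (k : ℝ → ℝ) (s : ℝ) {h : ℝ} (hh : 0 ≤ h) :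
    ∫ r in Ioo 0 h, k (s - r) = ∫ τ in Ioo (s - h) s, k τ := by
  rw [← integral_Ioc_eq_integral_Ioo, ← integral_Ioc_eq_integral_Ioo,
    ← intervalIntegral.integral_of_le hh, ← intervalIntegral.integral_of_le (by linarith),
    intervalIntegral.integral_comp_sub_left, sub_zero]

/-- Substituting `τ = s - r` and applying Fubini turns the pairing of `f` with a frozen slice of `g`
into an average over shifts `r` of pairings of the translated `f` with `g`. -/
theorem integral_slices_eq {N : ℕ} {E : Type*} [NormedAddCommGroup E]
    [InnerProductSpace ℝ E] {q p : ENNReal} [ENNReal.HolderTriple q p 1] [Fact (1 ≤ q)]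
    [Fact (q ≠ ⊤)] [Fact (1 ≤ p)] (hp : p ≠ ⊤) {f g : ℝ × Space N → E} (hfm : StronglyMeasurable f)
    (hgm : StronglyMeasurable g) (hf : MemLp f q) (hg : MemLp g p) {a b h : ℝ} (hh : 0 ≤ h) :
    Integrable (fun s => ∫ z in Ioo (s - h) s ×ˢ (univ : Set (Space N)),
      inner ℝ (f z) (g (s, z.2))) (volume.restrict (Ioo a b)) ∧
    ∫ s in Ioo a b, (∫ z in Ioo (s - h) s ×ˢ (univ : Set (Space N)), inner ℝ (f z) (g (s, z.2))) =
      ∫ r in Ioo 0 h, ∫ z in Ioo a b ×ˢ (univ : Set (Space N)),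
        inner ℝ (f (z.1 - r, z.2)) (g z) := by
  have hD : Integrable (fun w : ℝ × (ℝ × Space N) => inner ℝ (f (w.2.1 - w.1, w.2.2)) (g w.2))
      ((volume.restrict (Ioo 0 h)).prod (volume.restrict (Ioo a b ×ˢ (univ : Set (Space N))))) := by
    refine (integrable_inner_shift hfm hgm hf hg h).mono_measure ?_
    exact Measure.prod_mono le_rfl Measure.restrict_le_self
  have hZ : Integrable (fun z : ℝ × Space N => ∫ r in Ioo 0 h, inner ℝ (f (z.1 - r, z.2)) (g z))
      ((volume.restrict (Ioo a b)).prod volume) := by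
    have := hD.integral_prod_right
    rwa [Measure.volume_eq_prod, ← Measure.prod_restrict, Measure.restrict_univ] at this
  have hp0 : p ≠ 0 := (lt_of_lt_of_le one_pos (Fact.out : 1 ≤ p)).ne'
  have hsl : ∀ᵐ s ∂(volume.restrict (Ioo a b)),
      ∫ x : Space N, ∫ r in Ioo 0 h, inner ℝ (f (s - r, x)) (g (s, x)) =
        ∫ z in Ioo (s - h) s ×ˢ (univ : Set (Space N)), inner ℝ (f z) (g (s, z.2)) := by
    refine ae_restrict_of_ae ?_
    filter_upwards [ae_memLp_slice hp0 hp hgm hg] with s hs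
    rw [Measure.volume_eq_prod, ← Measure.prod_restrict, Measure.restrict_univ, integral_prod_symm]
    · refine integral_congr_ae (.of_forall fun x => ?_)
      exact setIntegral_Ioo_comp_sub_left (fun τ => inner ℝ (f (τ, x)) (g (s, x))) s hh
    · refine integrable_inner_of_memLp (q := q) (p := p) ?_ (hs.comp_snd _)
      exact hf.mono_measure (by
        rw [Measure.volume_eq_prod]
        exact Measure.prod_mono Measure.restrict_le_self le_rfl)
  refine ⟨hZ.integral_prod_left.congr hsl, ?_⟩
  rw [← integral_congr_ae hsl, ← integral_prod _ hZ,
    integral_integral_swap (f := fun (r : ℝ) (z : ℝ × Space N) =>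
      inner ℝ (f (z.1 - r, z.2)) (g z)) hD,
    Measure.volume_eq_prod ℝ (Space N), ← Measure.prod_restrict, Measure.restrict_univ]

/-- Integrating the hypothesis over `s` in `(a, b)` gives `Θ h ≤ 0` for small `h > 0`. As `Θ 0 = 0`,
the right derivative at `0` is nonpositive, and that is the claim. -/
theorem energy_inequality_of_slices {N : ℕ} {E : Type*} [NormedAddCommGroup E]
    [InnerProductSpace ℝ E] {q p : ENNReal} [ENNReal.HolderTriple q p 1] [Fact (1 ≤ q)]
    [Fact (q ≠ ⊤)] [Fact (1 ≤ p)] (hp : p ≠ ⊤) {f g : ℝ × Space N → E} (hfm : StronglyMeasurable f)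
    (hgm : StronglyMeasurable g) (hf : MemLp f q) (hg : MemLp g p) {y : ℝ → ℝ} (hy : Continuous y)
    {T : ℝ} (hineq : ∀ᵐ s ∂(volume.restrict (Ioo 0 T)), ∀ h, 0 < h → h < s →
      y s - y (s - h) ≤ -2 * ∫ z in Ioo (s - h) s ×ˢ (univ : Set (Space N)),
        inner ℝ (f z) (g (s, z.2)))
    {a b : ℝ} (ha : 0 < a) (hab : a ≤ b) (hb : b < T) :
    y b - y a ≤ -2 * ∫ z in Ioo a b ×ˢ (univ : Set (Space N)), inner ℝ (f z) (g z) := by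
  set J : ℝ → ℝ := fun r => ∫ z in Ioo a b ×ˢ (univ : Set (Space N)),
    inner ℝ (f (z.1 - r, z.2)) (g z) with hJ
  have hS : MeasurableSet (Ioo a b ×ˢ (univ : Set (Space N))) :=
    measurableSet_Ioo.prod MeasurableSet.univ
  -- The cutoff to `(a, b)` is put on `g`, because only `f` is translated.
  have hJc : Continuous J := by
    refine (continuous_integral_inner_shift hf (hg.indicator hS)).congr fun r => ?_
    simp only [hJ]
    rw [← integral_indicator hS]
    congr 1
    ext z
    by_cases hz : z ∈ Ioo a b ×ˢ (univ : Set (Space N))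
    · simp only [indicator_of_mem hz]
    · simp only [indicator_of_notMem hz, inner_zero_right]
  have hJ0 : J 0 = ∫ z in Ioo a b ×ˢ (univ : Set (Space N)), inner ℝ (f z) (g z) := by
    simp [hJ]
  set Y : ℝ → ℝ := fun t => ∫ s in (0 : ℝ)..t, y s with hY
  have hYd : ∀ t, HasDerivAt Y (y t) t := fun t =>
    intervalIntegral.integral_hasDerivAt_right (hy.intervalIntegrable _ _)
      hy.stronglyMeasurable.stronglyMeasurableAtFilter hy.continuousAt
  have hYi : ∀ s t, ∫ r in s..t, y r = Y t - Y s := fun s t =>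
    (intervalIntegral.integral_interval_sub_left (hy.intervalIntegrable _ _)
      (hy.intervalIntegrable _ _)).symm
  set Θ : ℝ → ℝ := fun h => (Y b - Y a) - (Y (b - h) - Y (a - h)) +
    2 * ∫ r in (0 : ℝ)..h, J r with hΘ
  have hΘd : HasDerivAt Θ (y b - y a + 2 * J 0) 0 := by
    have hs : ∀ c, HasDerivAt (fun h : ℝ => Y (c - h)) (-y c) 0 := fun c => by
      have h1 : HasDerivAt Y (y c) (c - 0) := by simpa using hYd c
      simpa using HasDerivAt.comp_const_sub c 0 h1
    have hJd : HasDerivAt (fun h => ∫ r in (0 : ℝ)..h, J r) (J 0) 0 :=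
      intervalIntegral.integral_hasDerivAt_right (hJc.intervalIntegrable _ _)
        hJc.stronglyMeasurable.stronglyMeasurableAtFilter hJc.continuousAt
    have := (((hs b).sub (hs a)).const_sub (Y b - Y a)).add (hJd.const_mul 2)
    rwa [show -(-y b - -y a) = y b - y a by ring] at this
  have hΘle : ∀ h, 0 < h → h < a → Θ h ≤ 0 := by
    intro h h0 ha'
    obtain ⟨hi, he⟩ := integral_slices_eq hp hfm hgm hf hg (a := a) (b := b) h0.le
    have hyi : Integrable (fun s => y s - y (s - h)) (volume.restrict (Ioo a b)) :=
      (Continuous.integrableOn_Icc (by fun_prop)).mono_set Ioo_subset_Icc_self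
    have hsub : ∀ᵐ s ∂(volume.restrict (Ioo a b)), y s - y (s - h) ≤
        -2 * ∫ z in Ioo (s - h) s ×ˢ (univ : Set (Space N)), inner ℝ (f z) (g (s, z.2)) := by
      filter_upwards [ae_restrict_of_ae_restrict_of_subset
        (Ioo_subset_Ioo ha.le hb.le) hineq, ae_restrict_mem measurableSet_Ioo] with s hs hs'
      exact hs h h0 (ha'.trans hs'.1)
    have hle := integral_mono_ae hyi (hi.const_mul (-2)) hsub
    rw [integral_const_mul, he, ← integral_Ioc_eq_integral_Ioo, ← integral_Ioc_eq_integral_Ioo,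
      ← intervalIntegral.integral_of_le hab, ← intervalIntegral.integral_of_le h0.le,
      intervalIntegral.integral_sub (hy.intervalIntegrable _ _)
        ((by fun_prop : Continuous fun s => y (s - h)).intervalIntegrable _ _),
      intervalIntegral.integral_comp_sub_right, hYi, hYi] at hle
    simp only [hΘ]
    linarith
  have hΘ0 : Θ 0 = 0 := by simp [hΘ]
  have hlim := (hasDerivWithinAt_iff_tendsto_slope' (s := Ioi 0) (by simp)).1
    (hΘd.hasDerivWithinAt (s := Ioi 0))
  have hfin : y b - y a + 2 * J 0 ≤ 0 := by
    refine le_of_tendsto hlim ?_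
    filter_upwards [Ioo_mem_nhdsGT ha] with h hh
    rw [slope_def_field, hΘ0, sub_zero, sub_zero]
    exact div_nonpos_of_nonpos_of_nonneg (hΘle h hh.1 hh.2) hh.1.le
  rw [hJ0] at hfin
  linarith

/-! ### Energy inequality for weak solutions -/

theorem volume_restrict_Ioo_prod {N : ℕ} (Ω : Set (Space N)) (a b : ℝ) :
    (volume : Measure (ℝ × Space N)).restrict (Ioo a b ×ˢ Ω) =
      (volume.restrict (Ioo a b)).prod (volume.restrict Ω) := by
  rw [Measure.volume_eq_prod, Measure.prod_restrict]

theorem MemW1pZero.congr_grad {N : ℕ} {Ω : Set (Space N)} {p : ℝ} {f : Space N → ℝ}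
    {G G' : Space N → Space N} (h : MemW1pZero Ω p f G) (hG : G =ᵐ[volume.restrict Ω] G') :
    MemW1pZero Ω p f G' where
  memLp := h.memLp
  memLp_grad := h.memLp_grad.ae_eq hG
  weak_grad φ hφ i := by
    rw [h.weak_grad φ hφ i]
    congr 1
    refine integral_congr_ae ?_
    filter_upwards [hG] with x hx
    rw [hx]
  approx := by
    obtain ⟨φ, h1, h2, h3⟩ := h.approx
    refine ⟨φ, h1, h2, h3.congr fun k => eLpNorm_congr_ae ?_⟩
    filter_upwards [hG] with x hx
    rw [hx]

theorem isParabolicTest_const {N : ℕ} {Ω : Set (Space N)} {T p : ℝ}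
    {f : Space N → ℝ} {G : Space N → Space N} (h : MemW1pZero Ω p f G)
    (h2 : MemLp f 2 (volume.restrict Ω)) :
    IsParabolicTest Ω T p (fun _ => f) (fun _ _ => 0) (fun _ => G) where
  memLp := by
    rw [cylinder, volume_restrict_Ioo_prod]
    exact h.memLp.comp_snd _
  memLp_grad := by
    rw [cylinder, volume_restrict_Ioo_prod]
    exact h.memLp_grad.comp_snd _
  zero_trace := .of_forall fun _ => h
  memLp_slice _ _ := h2
  memLp_deriv := MemLp.zero'
  time_deriv s _ t _ := .of_forall fun x => by simp

/-- The weak formulation tested with `u(s) - c`, constant in time. The gradient is replaced by a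
strongly measurable representative extended by zero outside the cylinder, so that it can be
translated in time on the whole space. -/
theorem IsWeakSolution.exists_gradient {N : ℕ} {Ω : Set (Space N)} (hΩo : IsOpen Ω)
    (hΩ : volume Ω ≠ ⊤) {T p c : ℝ} {u₀ : Space N → ℝ} {u : ℝ → Space N → ℝ}
    (hu : IsWeakSolution Ω T p u₀ c u) :
    ∃ G : ℝ × Space N → Space N, StronglyMeasurable G ∧ MemLp G (ENNReal.ofReal p) ∧
      ∀ᵐ s ∂(volume.restrict (Ioo 0 T)),
        MemW1pZero Ω p (fun x => u s x - c) (fun x => G (s, x)) ∧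
        ∀ t₁ t₂, 0 ≤ t₁ → t₁ ≤ t₂ → t₂ ≤ T →
          (∫ x in Ω, u t₂ x * (u s x - c)) - (∫ x in Ω, u t₁ x * (u s x - c)) =
            -∫ z in Ioo t₁ t₂ ×ˢ (univ : Set (Space N)),
              inner ℝ (‖G z‖ ^ (p - 2) • G z) (G (s, z.2)) := by
  obtain ⟨hu2, -, -, G₀, -, hG₀, htr, heq⟩ := hu
  have : IsFiniteMeasure (volume.restrict Ω) := ⟨by simpa using hΩ.lt_top⟩
  have hcyl : MeasurableSet (cylinder Ω T) := measurableSet_Ioo.prod hΩo.measurableSet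
  set G : ℝ × Space N → Space N := (cylinder Ω T).indicator (hG₀.1.mk _) with hG
  have hGm : StronglyMeasurable G := hG₀.1.stronglyMeasurable_mk.indicator hcyl
  have hGG₀ : ∀ᵐ z ∂(volume.restrict (cylinder Ω T)), G₀ z.1 z.2 = G z := by
    filter_upwards [hG₀.1.ae_eq_mk, ae_restrict_mem hcyl] with z hz hz'
    rw [hG, indicator_of_mem hz', ← hz, Function.uncurry]
  have hG0 : ∀ z ∉ cylinder Ω T, G z = 0 := fun z hz => indicator_of_notMem hz _
  have hslice : ∀ᵐ s ∂(volume.restrict (Ioo 0 T)),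
      ∀ᵐ x ∂(volume.restrict Ω), G₀ s x = G (s, x) := by
    rw [cylinder, volume_restrict_Ioo_prod] at hGG₀
    exact Measure.ae_ae_of_ae_prod hGG₀
  refine ⟨G, hGm, (memLp_indicator_iff_restrict hcyl).2 (hG₀.ae_eq hG₀.1.ae_eq_mk), ?_⟩
  filter_upwards [htr, hslice, ae_restrict_mem measurableSet_Ioo] with s hs hsG hsT
  have hz := hs.2.congr_grad hsG
  have h2 : MemLp (fun x => u s x - c) 2 (volume.restrict Ω) :=
    (hu2 s ⟨hsT.1.le, hsT.2.le⟩).sub (memLp_const c)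
  refine ⟨hz, fun t₁ t₂ h0 h12 h2T => ?_⟩
  have he := heq _ _ _ (isParabolicTest_const hz h2) t₁ t₂ h0 h12 h2T
  have hsub : Ioo t₁ t₂ ×ˢ Ω ⊆ cylinder Ω T := prod_mono (Ioo_subset_Ioo h0 h2T) subset_rfl
  have hint : ∫ z in Ioo t₁ t₂ ×ˢ Ω, (-(u z.1 z.2 * 0) +
      ‖G₀ z.1 z.2‖ ^ (p - 2) * inner ℝ (G₀ z.1 z.2) (G (s, z.2))) =
      ∫ z in Ioo t₁ t₂ ×ˢ (univ : Set (Space N)),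
        inner ℝ (‖G z‖ ^ (p - 2) • G z) (G (s, z.2)) := by
    rw [setIntegral_eq_of_subset_of_forall_sdiff_eq_zero
      (s := Ioo t₁ t₂ ×ˢ Ω) (t := Ioo t₁ t₂ ×ˢ univ)
      (measurableSet_Ioo.prod MeasurableSet.univ) (prod_mono subset_rfl (subset_univ _))]
    · refine integral_congr_ae ?_
      filter_upwards [ae_restrict_of_ae_restrict_of_subset hsub hGG₀] with z hz
      rw [hz, real_inner_smul_left]
      ring
    · intro z hz
      have : z ∉ cylinder Ω T := fun h => hz.2 ⟨hz.1.1, h.2⟩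
      simp [hG0 z this]
  rw [hint] at he
  linarith

theorem continuousOn_integral_sq {α : Type*} [MeasurableSpace α] {μ : Measure α} {S : Set ℝ}
    {v : ℝ → α → ℝ} (hv : ∀ t ∈ S, MemLp (v t) 2 μ)
    (hc : ∀ s ∈ S, Tendsto (fun t => eLpNorm (fun x => v t x - v s x) 2 μ) (𝓝[S] s) (𝓝 0)) :
    ContinuousOn (fun t => ∫ x, v t x ^ 2 ∂μ) S := by
  have hN : ContinuousOn (fun t => (eLpNorm (v t) 2 μ).toReal) S := by
    intro s hs
    rw [ContinuousWithinAt, tendsto_iff_dist_tendsto_zero]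
    have h0 : Tendsto (fun t => (eLpNorm (fun x => v t x - v s x) 2 μ).toReal) (𝓝[S] s)
        (𝓝 0) := by
      exact (ENNReal.tendsto_toReal ENNReal.zero_ne_top).comp (hc s hs)
    refine squeeze_zero' (.of_forall fun _ => dist_nonneg) ?_ h0
    filter_upwards [self_mem_nhdsWithin] with t ht
    have := abs_norm_sub_norm_le ((hv t ht).toLp _) ((hv s hs).toLp _)
    rwa [← MemLp.toLp_sub, Lp.norm_toLp, Lp.norm_toLp, Lp.norm_toLp] at this
  refine (hN.pow 2).congr fun t ht => ?_
  rw [Pi.pow_apply, eLpNorm_two_eq_sqrt (hv t ht), ENNReal.toReal_ofReal (Real.sqrt_nonneg _),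
    Real.sq_sqrt (integral_nonneg fun x => by positivity)]
  simp

theorem IsWeakSolution.continuousOn_energy {N : ℕ} {Ω : Set (Space N)}
    (hΩ : volume Ω ≠ ⊤) {T p c : ℝ} {u₀ : Space N → ℝ} {u : ℝ → Space N → ℝ}
    (hu : IsWeakSolution Ω T p u₀ c u) :
    ContinuousOn (fun t => ∫ x in Ω, (u t x - c) ^ 2) (Icc 0 T) := by
  have : IsFiniteMeasure (volume.restrict Ω) := ⟨by simpa using hΩ.lt_top⟩
  refine continuousOn_integral_sq (fun t ht => (hu.1 t ht).sub (memLp_const c)) fun s hs => ?_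
  simpa using hu.2.1 s hs

theorem memLp_norm_rpow_smul {α E : Type*} [MeasurableSpace α] {μ : Measure α}
    [NormedAddCommGroup E] [NormedSpace ℝ E] {p : ℝ} (hp : 2 < p) {G : α → E}
    (hG : MemLp G (ENNReal.ofReal p) μ) :
    MemLp (fun z => ‖G z‖ ^ (p - 2) • G z) (ENNReal.ofReal (p / (p - 1))) μ := by
  have h := hG.norm_rpow_div (ENNReal.ofReal (p - 1))
  rw [ENNReal.toReal_ofReal (by linarith), ← ENNReal.ofReal_div_of_pos (by linarith)] at h
  refine h.of_le ((hG.1.norm.aemeasurable.pow_const _).aestronglyMeasurable.smul hG.1)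
    (.of_forall fun z => ?_)
  rw [norm_smul, Real.norm_of_nonneg (by positivity), Real.norm_of_nonneg (by positivity),
    show p - 1 = p - 2 + 1 by ring, Real.rpow_add_one' (norm_nonneg _) (by linarith)]

theorem IsWeakSolution.exists_energy_inequality {N : ℕ} {Ω : Set (Space N)} (hΩo : IsOpen Ω)
    (hΩ : volume Ω ≠ ⊤) {T p c : ℝ} (hT : 0 < T) (hp : 2 < p) {u₀ : Space N → ℝ}
    {u : ℝ → Space N → ℝ} (hu : IsWeakSolution Ω T p u₀ c u) :
    ∃ G : ℝ × Space N → Space N,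
      Integrable (fun z => ‖G z‖ ^ p) ∧
      (∀ᵐ s ∂(volume.restrict (Ioo 0 T)),
        MemW1pZero Ω p (fun x => u s x - c) (fun x => G (s, x))) ∧
      ∀ a b, 0 < a → a ≤ b → b < T →
        (∫ x in Ω, (u b x - c) ^ 2) - (∫ x in Ω, (u a x - c) ^ 2) ≤
          -2 * ∫ z in Ioo a b ×ˢ (univ : Set (Space N)), ‖G z‖ ^ p := by
  have : IsFiniteMeasure (volume.restrict Ω) := ⟨by simpa using hΩ.lt_top⟩
  obtain ⟨G, hGm, hG, hGs⟩ := hu.exists_gradient hΩo hΩ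
  have hP0 : ENNReal.ofReal p ≠ 0 := by simpa using (by linarith : 0 < p)
  have hint : Integrable (fun z => ‖G z‖ ^ p) := by
    simpa [ENNReal.toReal_ofReal (by linarith : 0 ≤ p)] using
      hG.integrable_norm_rpow hP0 ENNReal.ofReal_ne_top
  refine ⟨G, hint, hGs.mono fun s hs => hs.1, fun a b ha hab hb => ?_⟩
  set y : ℝ → ℝ := fun t => ∫ x in Ω, (u t x - c) ^ 2 with hy
  have hyc : ContinuousOn y (Icc 0 T) := hu.continuousOn_energy hΩ
  -- The translation argument needs a function continuous on all of `ℝ`; only its values on `[0, T]`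
  -- matter.
  set Y : ℝ → ℝ := IccExtend hT.le ((Icc 0 T).domRestrict y) with hY
  have hYc : Continuous Y := hyc.domRestrict.Icc_extend'
  have hYy : ∀ t ∈ Icc 0 T, Y t = y t := fun t ht => IccExtend_of_mem hT.le _ ht
  have hH : (p / (p - 1)).HolderConjugate p := (Real.HolderConjugate.conjExponent (by linarith)).symm
  have : ENNReal.HolderTriple (ENNReal.ofReal (p / (p - 1))) (ENNReal.ofReal p) 1 :=
    hH.ennrealOfReal
  have : Fact (1 ≤ ENNReal.ofReal (p / (p - 1))) :=
    ⟨by rw [ENNReal.one_le_ofReal, le_div_iff₀] <;> linarith⟩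
  have : Fact (ENNReal.ofReal (p / (p - 1)) ≠ ⊤) := ⟨ENNReal.ofReal_ne_top⟩
  have : Fact (1 ≤ ENNReal.ofReal p) := ⟨by rw [ENNReal.one_le_ofReal]; linarith⟩
  have hmem : ∀ t ∈ Icc 0 T, MemLp (fun x => u t x - c) 2 (volume.restrict Ω) := fun t ht =>
    (hu.1 t ht).sub (memLp_const c)
  have hineq : ∀ᵐ s ∂(volume.restrict (Ioo 0 T)), ∀ h, 0 < h → h < s →
      Y s - Y (s - h) ≤ -2 * ∫ z in Ioo (s - h) s ×ˢ (univ : Set (Space N)),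
        inner ℝ (‖G z‖ ^ (p - 2) • G z) (G (s, z.2)) := by
    filter_upwards [hGs, ae_restrict_mem measurableSet_Ioo] with s hs hsT h h0 hhs
    have ms : s ∈ Icc 0 T := ⟨hsT.1.le, hsT.2.le⟩
    have msh : s - h ∈ Icc 0 T := ⟨by linarith, by linarith [hsT.2]⟩
    have he := hs.2 (s - h) s msh.1 (by linarith) ms.2
    rw [hYy s ms, hYy _ msh]
    have i1 := (hmem s ms).integrable_sq
    have i2 := (hmem _ msh).integrable_sq
    have i3 : Integrable (fun x => u s x * (u s x - c)) (volume.restrict Ω) :=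
      (hu.1 s ms).integrable_mul (hmem s ms)
    have i4 : Integrable (fun x => u (s - h) x * (u s x - c)) (volume.restrict Ω) :=
      (hu.1 _ msh).integrable_mul (hmem s ms)
    -- Pointwise `A² - B² ≤ 2 (A - B) A` with `A = u(s) - c` and `B = u(s - h) - c`; the defect is
    -- `(A - B)²`.
    have hle : y s - y (s - h) ≤ 2 * ((∫ x in Ω, u s x * (u s x - c)) -
        ∫ x in Ω, u (s - h) x * (u s x - c)) := by
      rw [← integral_sub i1 i2, ← integral_sub i3 i4, ← integral_const_mul]
      refine integral_mono (i1.sub i2) ((i3.sub i4).const_mul 2) fun x => ?_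
      nlinarith [sq_nonneg (u s x - u (s - h) x)]
    rw [he] at hle
    linarith
  have hfm : StronglyMeasurable fun z => ‖G z‖ ^ (p - 2) • G z :=
    (hGm.norm.measurable.pow_const _).stronglyMeasurable.smul hGm
  have hfin := energy_inequality_of_slices ENNReal.ofReal_ne_top hfm hGm
    (memLp_norm_rpow_smul hp hG) hG hYc hineq ha hab hb
  rw [hYy b ⟨by linarith, hb.le⟩, hYy a ⟨ha.le, by linarith⟩] at hfin
  convert hfin using 4 with z
  rw [real_inner_smul_left, real_inner_self_eq_norm_sq, ← Real.rpow_two,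
    ← Real.rpow_add' (norm_nonneg _) (by linarith)]
  congr 1
  ring

/-! ### Universal bound and divergence -/

/-- The order of quantifiers is the point: `κ` is chosen before the datum, the boundary value and
the solution. It combines the energy inequality, Poincaré on a.e. slice, and `rpow_decay` with `q =
p / 2`. -/
theorem exists_universal_energy_bound {N : ℕ} (hN : 1 ≤ N) {Ω : Set (Space N)} (hΩo : IsOpen Ω)
    (hΩ : Bornology.IsBounded Ω) {T p : ℝ} (hT : 0 < T) (hp : 2 < p) :
    ∃ κ > 0, ∀ (u₀ : Space N → ℝ) (c : ℝ) (u : ℝ → Space N → ℝ), IsWeakSolution Ω T p u₀ c u →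
      ∀ t ∈ Ioo 0 T, ∫ x in Ω, (u t x - c) ^ 2 ≤ (κ * t) ^ (-(p / 2 - 1)⁻¹) := by
  have hfin : volume Ω ≠ ⊤ := hΩ.measure_lt_top.ne
  obtain ⟨k, hk, hpoin⟩ := exists_poincare hN hΩ hp
  have hq : 1 < p / 2 := by linarith
  have hr1 : (2 : ℝ) ^ (1 - p / 2) < 1 :=
    Real.rpow_lt_one_of_one_lt_of_neg (by norm_num) (by linarith)
  refine ⟨2 * k * (1 - (2 : ℝ) ^ (1 - p / 2)), by have := sub_pos.2 hr1; positivity,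
    fun u₀ c u hu t ht => ?_⟩
  obtain ⟨G, hGi, hGs, hen⟩ := hu.exists_energy_inequality hΩo hfin hT hp
  set y : ℝ → ℝ := fun t => ∫ x in Ω, (u t x - c) ^ 2 with hy
  have hyc : ContinuousOn y (Icc 0 T) := hu.continuousOn_energy hfin
  obtain ⟨B, hB⟩ := isCompact_Icc.bddAbove_image hyc
  have hy0 : ∀ t, 0 ≤ y t := fun t => integral_nonneg fun x => sq_nonneg _
  -- Monotonicity lets `y s` be replaced by `y b` from below for every `s` in `(a, b)`.
  have hanti : ∀ a b, 0 < a → a ≤ b → b < T → y b ≤ y a := by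
    intro a b ha hab hb
    have h1 := hen a b ha hab hb
    have h2 : 0 ≤ ∫ z in Ioo a b ×ˢ (univ : Set (Space N)), ‖G z‖ ^ p :=
      integral_nonneg fun z => by positivity
    linarith
  have hdec : ∀ a b, 0 < a → a < b → b < T → y b - y a ≤ -(2 * k * (b - a) * y b ^ (p / 2)) := by
    intro a b ha hab hb
    refine (hen a b ha hab.le hb).trans ?_
    have hGp : Integrable (fun z => ‖G z‖ ^ p) ((volume : Measure ℝ).prod volume) := hGi
    have hGab : Integrable (fun z => ‖G z‖ ^ p)
        ((volume.restrict (Ioo a b)).prod (volume : Measure (Space N))) :=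
      hGp.mono_measure (Measure.prod_mono Measure.restrict_le_self le_rfl)
    rw [volume_restrict_Ioo_prod, Measure.restrict_univ, integral_prod _ hGab]
    have hlow : ∀ᵐ s ∂(volume.restrict (Ioo a b)),
        k * y b ^ (p / 2) ≤ ∫ x, ‖G (s, x)‖ ^ p := by
      filter_upwards [ae_restrict_of_ae_restrict_of_subset (Ioo_subset_Ioo ha.le hb.le) hGs,
        ae_restrict_of_ae hGp.prod_right_ae, ae_restrict_mem measurableSet_Ioo] with s h1 h2 h3
      calc k * y b ^ (p / 2) ≤ k * y s ^ (p / 2) := by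
            have := hanti s b (ha.trans h3.1) h3.2.le hb
            have := hy0 b
            gcongr
        _ ≤ ∫ x in Ω, ‖G (s, x)‖ ^ p := hpoin _ _ h1
        _ ≤ ∫ x, ‖G (s, x)‖ ^ p :=
          setIntegral_le_integral h2 (.of_forall fun x => by positivity)
    have := integral_mono_ae (integrable_const _) hGab.integral_prod_left hlow
    rw [integral_const, measureReal_restrict_apply_univ, Real.volume_real_Ioo_of_le hab.le,
      smul_eq_mul] at this
    linarith
  have := rpow_decay (by positivity) hq (fun t ht => hB ⟨t, ⟨ht.1.le, ht.2.le⟩, rfl⟩) hdec ht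
  refine this.trans (le_of_eq ?_)
  congr 1
  ring

theorem IsWeakSolution.aestronglyMeasurable {N : ℕ} {Ω : Set (Space N)} {T p c : ℝ}
    {u₀ : Space N → ℝ} {u : ℝ → Space N → ℝ} (hu : IsWeakSolution Ω T p u₀ c u) :
    AEStronglyMeasurable (Function.uncurry u) (volume.restrict (cylinder Ω T)) := by
  obtain ⟨-, -, -, G, h, -⟩ := hu
  exact h.1

/-- The universal bound decreases in `t`, so away from `t = 0` its value at `T / 2` serves for all
times. -/
theorem exists_lintegral_sq_bound {N : ℕ} (hN : 1 ≤ N) {Ω : Set (Space N)} (hΩo : IsOpen Ω)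
    (hΩ : Bornology.IsBounded Ω) {T p : ℝ} (hT : 0 < T) (hp : 2 < p) :
    ∃ K : ENNReal, K ≠ ⊤ ∧ ∀ (u₀ : Space N → ℝ) (c : ℝ) (u : ℝ → Space N → ℝ),
      IsWeakSolution Ω T p u₀ c u →
      ∫⁻ z in Ioo (T / 2) T ×ˢ Ω, ENNReal.ofReal ((u z.1 z.2 - c) ^ 2) ≤ K := by
  obtain ⟨κ, hκ, hb⟩ := exists_universal_energy_bound hN hΩo hΩ hT hp
  have : IsFiniteMeasure (volume.restrict Ω) := ⟨by simpa using hΩ.measure_lt_top⟩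
  set M := (κ * (T / 2)) ^ (-(p / 2 - 1)⁻¹) with hM
  refine ⟨ENNReal.ofReal M * volume (Ioo (T / 2) T), ENNReal.mul_ne_top ENNReal.ofReal_ne_top
    measure_Ioo_lt_top.ne, fun u₀ c u hu => ?_⟩
  have hsub : Ioo (T / 2) T ×ˢ Ω ⊆ cylinder Ω T :=
    prod_mono (Ioo_subset_Ioo (by linarith) le_rfl) subset_rfl
  have hm := hu.aestronglyMeasurable.mono_measure (Measure.restrict_mono hsub le_rfl)
  rw [volume_restrict_Ioo_prod] at hm ⊢
  have hm' : AEMeasurable (fun z : ℝ × Space N => ENNReal.ofReal ((u z.1 z.2 - c) ^ 2))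
      ((volume.restrict (Ioo (T / 2) T)).prod (volume.restrict Ω)) :=
    ((hm.aemeasurable.sub_const c).pow_const 2).ennreal_ofReal
  rw [lintegral_prod _ hm']
  calc ∫⁻ t in Ioo (T / 2) T, ∫⁻ x in Ω, ENNReal.ofReal ((u t x - c) ^ 2)
      ≤ ∫⁻ t in Ioo (T / 2) T, ENNReal.ofReal M := by
        refine setLIntegral_mono' measurableSet_Ioo fun t ht => ?_
        have ht' : t ∈ Ioo 0 T := ⟨by linarith [ht.1], ht.2⟩
        have hi : MemLp (fun x => u t x - c) 2 (volume.restrict Ω) :=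
          (hu.1 t ⟨ht'.1.le, ht'.2.le⟩).sub (memLp_const c)
        rw [← ofReal_integral_eq_lintegral_ofReal hi.integrable_sq
          (.of_forall fun x => sq_nonneg _)]
        refine ENNReal.ofReal_le_ofReal ((hb u₀ c u hu t ht').trans ?_)
        refine Real.rpow_le_rpow_of_nonpos (by positivity) ?_ ?_
        · exact mul_le_mul_of_nonneg_left ht.1.le hκ.le
        · have : 0 < p / 2 - 1 := by linarith
          exact neg_nonpos.2 (by positivity)
    _ = ENNReal.ofReal M * volume (Ioo (T / 2) T) := by
        rw [lintegral_const, Measure.restrict_apply_univ]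

theorem ae_tendsto_atTop {N : ℕ} (hN : 1 ≤ N) {Ω : Set (Space N)} (hΩo : IsOpen Ω)
    (hΩ : Bornology.IsBounded Ω) {T p : ℝ} (hT : 0 < T) (hp : 2 < p)
    {g : ℕ → Space N → ℝ} {u : ℕ → ℝ → Space N → ℝ}
    (hu : ∀ n : ℕ, 1 ≤ n → IsWeakSolution Ω T p (g n) (n : ℝ) (u n)) :
    ∀ᵐ z ∂(volume.restrict (Ioo (T / 2) T ×ˢ Ω)),
      Tendsto (fun n : ℕ => u n z.1 z.2) atTop atTop := by
  obtain ⟨K, hK, hb⟩ := exists_lintegral_sq_bound hN hΩo hΩ hT hp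
  set ν := (volume : Measure (ℝ × Space N)).restrict (Ioo (T / 2) T ×ˢ Ω) with hν
  have hsub : Ioo (T / 2) T ×ˢ Ω ⊆ cylinder Ω T :=
    prod_mono (Ioo_subset_Ioo (by linarith) le_rfl) subset_rfl
  -- The weights `1/n²` are summable, yet convergence of the sum still forces `|u_n - n| = o(n)`.
  -- The shift by one respects `1 ≤ n`.
  set F : ℕ → ℝ × Space N → ENNReal := fun n z =>
    ENNReal.ofReal (1 / ((n + 1 : ℕ) : ℝ) ^ 2) *
      ENNReal.ofReal ((u (n + 1) z.1 z.2 - (n + 1 : ℕ)) ^ 2) with hF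
  have hFm : ∀ n, AEMeasurable (F n) ν := fun n => by
    have hm := (hu (n + 1) (by omega)).aestronglyMeasurable.mono_measure
      (Measure.restrict_mono hsub le_rfl)
    exact ((hm.aemeasurable.sub_const _).pow_const 2).ennreal_ofReal.const_mul _
  have hsum : Summable fun n : ℕ => 1 / ((n + 1 : ℕ) : ℝ) ^ 2 :=
    (summable_nat_add_iff 1).2 (Real.summable_one_div_nat_pow.2 one_lt_two)
  have hfin : ∫⁻ z, ∑' n, F n z ∂ν ≠ ⊤ := by
    rw [lintegral_tsum hFm]
    refine ne_top_of_le_ne_top (b := ∑' n : ℕ, ENNReal.ofReal (1 / ((n + 1 : ℕ) : ℝ) ^ 2) * K)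
      ?_ (ENNReal.tsum_le_tsum fun n => ?_)
    · rw [ENNReal.tsum_mul_right]
      exact ENNReal.mul_ne_top hsum.tsum_ofReal_ne_top hK
    · rw [lintegral_const_mul' _ _ ENNReal.ofReal_ne_top]
      gcongr
      exact hb _ _ _ (hu (n + 1) (by omega))
  filter_upwards [ae_lt_top' (AEMeasurable.tsum hFm) hfin] with z hz
  have hlim := ENNReal.tendsto_atTop_zero_of_tsum_ne_top hz.ne
  rw [← tendsto_add_atTop_iff_nat 1]
  have hhalf : Tendsto (fun n : ℕ => ((n + 1 : ℕ) : ℝ) / 2) atTop atTop :=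
    (tendsto_natCast_atTop_atTop.comp (tendsto_add_atTop_nat 1)).atTop_div_const two_pos
  refine tendsto_atTop_mono' _ ?_ hhalf
  -- A term below `1/4` means `|u_n - n| < n/2`, hence `u_n > n/2`.
  have hq : (0 : ENNReal) < ENNReal.ofReal (1 / 4) := by simp
  filter_upwards [hlim.eventually (gt_mem_nhds hq)] with n hn
  have hpos : (0 : ℝ) < ((n + 1 : ℕ) : ℝ) := by positivity
  simp only [hF] at hn
  rw [← ENNReal.ofReal_mul (by positivity), ENNReal.ofReal_lt_ofReal_iff (by norm_num),
    one_div_mul_eq_div, div_lt_iff₀ (by positivity)] at hn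
  nlinarith [abs_lt_of_sq_lt_sq (a := u (n + 1) z.1 z.2 - (n + 1 : ℕ))
    (b := ((n + 1 : ℕ) : ℝ) / 2) (by linarith) (by positivity),
    neg_abs_le (u (n + 1) z.1 z.2 - (n + 1 : ℕ))]

end LargeSolutions

theorem proposition4p2 {N : ℕ} (hN : 1 ≤ N) (Ω : Set (LargeSolutions.Space N))
    (hΩ_open : IsOpen Ω) (hΩ_bdd : Bornology.IsBounded Ω) (hΩ_ne : Ω.Nonempty)
    (T : ℝ) (hT : 0 < T) (p : ℝ) (hp : 2 < p)
    (u : ℕ → ℝ → LargeSolutions.Space N → ℝ)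
    (hu : ∀ n : ℕ, 1 ≤ n →
      LargeSolutions.IsWeakSolution Ω T p (fun _ => 0) (n : ℝ) (u n)) :
    (∃ E : Set (ℝ × LargeSolutions.Space N),
      MeasurableSet E ∧ E ⊆ LargeSolutions.cylinder Ω T ∧ 0 < volume E ∧
      ∀ z ∈ E, Tendsto (fun n : ℕ => u n z.1 z.2) atTop atTop) ∧
    ∀ (g : ℕ → LargeSolutions.Space N → ℝ) (w : ℕ → ℝ → LargeSolutions.Space N → ℝ),
      (∀ n : ℕ, 1 ≤ n → (∀ᵐ x ∂(volume.restrict Ω), 0 ≤ g n x) ∧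
        LargeSolutions.IsWeakSolution Ω T p (g n) (n : ℝ) (w n)) →
      ¬ ∃ U : ℝ → LargeSolutions.Space N → ℝ, LargeSolutions.IsLargeSolution Ω T w U := by

  have hopen : IsOpen (Ioo (T / 2) T ×ˢ Ω) := isOpen_Ioo.prod hΩ_open
  have hpos : 0 < volume (Ioo (T / 2) T ×ˢ Ω) :=
    hopen.measure_pos _ ((nonempty_Ioo.2 (by linarith)).prod hΩ_ne)
  have hsub : Ioo (T / 2) T ×ˢ Ω ⊆ LargeSolutions.cylinder Ω T :=
    prod_mono (Ioo_subset_Ioo (by linarith) le_rfl) subset_rfl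
  constructor
  · have hae := LargeSolutions.ae_tendsto_atTop hN hΩ_open hΩ_bdd hT hp hu
    rw [ae_restrict_iff' hopen.measurableSet, ae_iff] at hae
    -- Divergence is required at every point of `E`, so a measurable null superset of the
    -- exceptional set is removed.
    set B := toMeasurable volume {z : ℝ × LargeSolutions.Space N |
      ¬(z ∈ Ioo (T / 2) T ×ˢ Ω → Tendsto (fun n : ℕ => u n z.1 z.2) atTop atTop)} with hB
    refine ⟨Ioo (T / 2) T ×ˢ Ω \ B, hopen.measurableSet.diff (measurableSet_toMeasurable _ _),
      sdiff_subset.trans hsub, ?_, fun z hz => ?_⟩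
    · rwa [measure_sdiff_null (by rw [hB, measure_toMeasurable, hae])]
    · by_contra h
      exact hz.2 (subset_toMeasurable _ _ fun h' => h (h' hz.1))
  · rintro g w hw ⟨U, hU⟩
    have hae := LargeSolutions.ae_tendsto_atTop hN hΩ_open hΩ_bdd hT hp fun n hn => (hw n hn).2
    have hle : ∀ᵐ z ∂(volume.restrict (Ioo (T / 2) T ×ˢ Ω)), ∀ n : ℕ, 1 ≤ n →
        w n z.1 z.2 ≤ U z.1 z.2 :=
      ae_all_iff.2 fun n => eventually_imp_distrib_left.2 fun hn =>
        ae_restrict_of_ae_restrict_of_subset hsub (hU.upper_barrier n hn)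
    have : (ae (volume.restrict (Ioo (T / 2) T ×ˢ Ω))).NeBot :=
      ae_restrict_neBot.2 hpos.ne'
    -- At such a point `w n` tends to infinity while staying below the real number `U z.1 z.2`.
    obtain ⟨z, hz, hzU⟩ := (hae.and hle).exists
    obtain ⟨n, hn, hn1⟩ :=
      ((hz.eventually_gt_atTop (U z.1 z.2)).and (eventually_ge_atTop 1)).exists
    exact absurd (hzU n hn1) (not_le.2 hn)
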